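/- For a finite group $G$, let $D(G)$ be the least positive integer $k$ such that every sequence $g_1,\dots,g_k$ of $k$ elements of $G$ has a non-empty ordered product-one subsequence, i.e. there are $m\ge 1$ and indices $1\le i_1<\dots<i_m\le k$ with $g_{i_1}g_{i_2}\cdots g_{i_m}=1$. For a finite $2$-group $G$, let $L(G)$ be the Loewy length of the group algebra $\mathbb{F}_2G$, i.e. the least $k$ with $J^k=0$, where $J$ is the Jacobson radical of $\mathbb{F}_2G$. Let $r$ be an integer and let $G$ be one of the following groups: \begin{itemize} \item $D_{2^r}=\langle x,y\mid x^{2}=y^{2^{r-1}}=1,\ x^{-1}yx=y^{-1}\rangle$ with $r\ge 3$; \item $Q_{2^r}=\langle x,y\mid x^{2}=y^{2^{r-2}},\ y^{2^{r-1}}=1,\ x^{-1}yx=y^{-1}\rangle$ with $r\ge 3$; \item $SD_{2^r}=\langle x,y\mid x^{2}=y^{2^{r-1}}=1,\ x^{-1}yx=y^{2^{r-2}-1}\rangle$ with $r\ge 4$; \item $M_{2^r}=\langle x,y\mid x^{2}=y^{2^{r-1}}=1,\ x^{-1}yx=y^{2^{r-2}+1}\rangle$ with $r\ge 4$. \end{itemize}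 Then $G$ has order $2^r$ and $D(G)=L(G)=2^{r-1}+1$. -/

import Mathlib

namespace TwoGroups

/-- `D(G)`: the least positive integer `k` such that every sequence of length `k` over `G` has a
non-empty ordered product-one subsequence, i.e. a non-empty subsequence (`List.Sublist` keeps the
order of the terms) whose product, taken in the given order, is `1`. -/
noncomputable def orderedDavenport (G : Type*) [Group G] : ℕ :=
  sInf {k : ℕ | 0 < k ∧ ∀ S : List G, S.length = k →
    ∃ T : List G, T ≠ [] ∧ T.Sublist S ∧ T.prod = 1}

/-- `L(G)` with respect to the prime `p`: the nilpotency index of the Jacobson radical of the group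
algebra `𝔽_p G`, i.e. the least `k` with `J ^ k = 0`. -/
noncomputable def loewyLength (p : ℕ) [Fact p.Prime] (G : Type*) [Group G] : ℕ :=
  sInf {k : ℕ | Ring.jacobson (MonoidAlgebra (ZMod p) G) ^ k = ⊥}

/-- The generator `x` of the free group on two letters. -/
abbrev x : FreeGroup (Fin 2) := FreeGroup.of 0

/-- The generator `y` of the free group on two letters. -/
abbrev y : FreeGroup (Fin 2) := FreeGroup.of 1

/-- `D_{2^r} = ⟨x, y | x^2 = y^(2^(r-1)) = 1, x⁻¹ y x = y⁻¹⟩`. -/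
abbrev Dihedral (r : ℕ) : Type :=
  PresentedGroup {x ^ 2, y ^ (2 ^ (r - 1)), (x⁻¹ * y * x) * (y⁻¹)⁻¹}

/-- `Q_{2^r} = ⟨x, y | x^2 = y^(2^(r-2)), y^(2^(r-1)) = 1, x⁻¹ y x = y⁻¹⟩`. -/
abbrev Quaternion (r : ℕ) : Type :=
  PresentedGroup {x ^ 2 * (y ^ (2 ^ (r - 2)))⁻¹, y ^ (2 ^ (r - 1)), (x⁻¹ * y * x) * (y⁻¹)⁻¹}

/-- `SD_{2^r} = ⟨x, y | x^2 = y^(2^(r-1)) = 1, x⁻¹ y x = y^(2^(r-2) - 1)⟩`. -/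
abbrev Semidihedral (r : ℕ) : Type :=
  PresentedGroup {x ^ 2, y ^ (2 ^ (r - 1)), (x⁻¹ * y * x) * (y ^ (2 ^ (r - 2) - 1))⁻¹}

/-- `M_{2^r} = ⟨x, y | x^2 = y^(2^(r-1)) = 1, x⁻¹ y x = y^(2^(r-2) + 1)⟩`. -/
abbrev Modular (r : ℕ) : Type :=
  PresentedGroup {x ^ 2, y ^ (2 ^ (r - 1)), (x⁻¹ * y * x) * (y ^ (2 ^ (r - 2) + 1))⁻¹}

end TwoGroups

namespace TwoGroups

open Polynomial MonoidAlgebra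

/-! Each group is generated by `a`, `b` with `a ^ 2 = b ^ t`, `b ^ 2 ^ s = 1`, `b * a = a * b ^ e`,
where `s = r - 1`, `t` is even and `e` is odd. Both invariants are squeezed to `2 ^ s + 1` through
the augmentation ideal `I` of the group algebra.

Upper bound: put `X = a - 1`, `Y = b - 1`. In characteristic 2, `X ^ 2` is a multiple of `Y ^ 2` and
every term of `Y * X` has weight at least 2 when `X` and `Y` have weight 1. So `I ^ k` lies in the
span of the `X ^ i * Y ^ j` with `i ≤ 1`, `i + j ≥ k`. As `Y ^ 2 ^ s = 0`, this span is zero for `k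
= 2 ^ s + 1` (`ker_augmentation_pow_eq_bot`). Then `I` is nilpotent and equals the Jacobson radical.

Lower bound and link: if a sequence has no product-one subsequence, the product of its `g - 1` is
non-zero (`prod_of_sub_one_ne_zero`). The sequence of `a` and `2 ^ s - 1` copies of `b` is of this
kind, because a permutation model shows that the normal forms do not collapse. -/

theorem two_eq_zero_of_algebra {A : Type*} [Ring A] [Algebra (ZMod 2) A] : (2 : A) = 0 := by
  rw [← map_ofNat (algebraMap (ZMod 2) A) 2, show (OfNat.ofNat 2 : ZMod 2) = 0 from rfl, map_zero]

/-! ### The weight filtration in `X` and `Y` -/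

section Filtration

variable {A : Type*} [Ring A] [Algebra (ZMod 2) A]

/-- The elements `Y ^ k * p(Y) + X * Y ^ (k - 1) * q(Y)`: the span of the monomials `X ^ i * Y ^ j`
with `i ≤ 1` and `i + j ≥ k`. -/
def weightSubmodule (X Y : A) (k : ℕ) : Submodule (ZMod 2) A where
  carrier := {z | ∃ p q : (ZMod 2)[X],
    z = aeval Y (Polynomial.X ^ k * p) + X * aeval Y (Polynomial.X ^ (k - 1) * q)}
  zero_mem' := ⟨0, 0, by simp⟩
  add_mem' := by
    rintro _ _ ⟨p, q, rfl⟩ ⟨p', q', rfl⟩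
    exact ⟨p + p', q + q', by simp only [mul_add, map_add]; abel⟩
  smul_mem' := by
    rintro c _ ⟨p, q, rfl⟩
    exact ⟨c • p, c • q, by simp only [mul_smul_comm, map_smul, smul_add]⟩

theorem weightSubmodule_succ_le (X Y : A) (k : ℕ) :
    weightSubmodule X Y (k + 1) ≤ weightSubmodule X Y k := by
  rintro _ ⟨p, q, rfl⟩
  -- Truncated subtraction makes `k - 1` equal to `0` for both `k = 0` and `k = 1`, so `q` is
  -- unchanged between these two levels.
  rcases k with _ | k
  · exact ⟨Polynomial.X * p, q, by simp⟩
  · exact ⟨Polynomial.X * p, Polynomial.X * q, by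
      simp only [add_tsub_cancel_right, pow_succ, mul_assoc]⟩

variable {X Y : A} {u w : (ZMod 2)[X]}

theorem X_mul_mem_weightSubmodule (hX : X * X = aeval Y (Polynomial.X ^ 2 * w)) {k : ℕ} {z : A}
    (hz : z ∈ weightSubmodule X Y k) : X * z ∈ weightSubmodule X Y (k + 1) := by
  obtain ⟨p, q, rfl⟩ := hz
  rcases k with _ | k
  · refine ⟨Polynomial.X * w * q, p, ?_⟩
    rw [mul_add, ← mul_assoc X X, hX, ← map_mul, add_comm]
    congr 2
    simp only [zero_tsub, zero_add]; ring
  · refine ⟨w * q, p, ?_⟩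
    rw [mul_add, ← mul_assoc X X, hX, ← map_mul, add_comm]
    congr 2
    simp only [add_tsub_cancel_right]; ring

/-- The terms `X * Y`, `X * Y ^ 2 * u` and `Y ^ 2 * u` of `Y * X` all have weight at least 2, so
moving `Y` past `X` loses no weight. -/
theorem Y_mul_mem_weightSubmodule
    (hYX : Y * X = X * aeval Y (Polynomial.X + Polynomial.X ^ 2 * u) +
      aeval Y (Polynomial.X ^ 2 * u)) {k : ℕ} {z : A}
    (hz : z ∈ weightSubmodule X Y k) : Y * z ∈ weightSubmodule X Y (k + 1) := by
  obtain ⟨p, q, rfl⟩ := hz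
  have key : ∀ f : (ZMod 2)[X], Y * aeval Y f = aeval Y (Polynomial.X * f) := by simp
  rcases k with _ | k
  · refine ⟨p + Polynomial.X * u * q, (Polynomial.X + Polynomial.X ^ 2 * u) * q, ?_⟩
    rw [mul_add, ← mul_assoc Y X, hYX, key, add_mul, ← map_mul, mul_assoc, ← map_mul,
      add_left_comm, ← map_add, add_comm]
    congr 2
    · simp only [zero_tsub, zero_add]; ring
    · simp only [zero_tsub, zero_add]; ring_nf
  · refine ⟨p + u * q, (1 + Polynomial.X * u) * q, ?_⟩
    rw [mul_add, ← mul_assoc Y X, hYX, key, add_mul, ← map_mul, mul_assoc, ← map_mul,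
      add_left_comm, ← map_add, add_comm]
    congr 2
    · simp only [add_tsub_cancel_right]; ring
    · simp only [add_tsub_cancel_right]; ring_nf

theorem aeval_mul_mem_weightSubmodule
    (hYX : Y * X = X * aeval Y (Polynomial.X + Polynomial.X ^ 2 * u) +
      aeval Y (Polynomial.X ^ 2 * u)) (f : (ZMod 2)[X]) {k : ℕ} {z : A}
    (hz : z ∈ weightSubmodule X Y k) : aeval Y f * z ∈ weightSubmodule X Y k := by
  induction f using Polynomial.induction_on' with
  | add p q hp hq => rw [map_add, add_mul]; exact add_mem hp hq
  | monomial n c =>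
    rw [aeval_monomial, ← Algebra.smul_def, smul_mul_assoc]
    refine Submodule.smul_mem _ _ ?_
    induction n with
    | zero => simpa using hz
    | succ n ih =>
      rw [pow_succ', mul_assoc]
      exact weightSubmodule_succ_le _ _ _ (Y_mul_mem_weightSubmodule hYX ih)

/-- The powers of the kernel of an augmentation are contained in the weight filtration. -/
theorem ker_pow_le_weightSubmodule (hX : X * X = aeval Y (Polynomial.X ^ 2 * w))
    (hYX : Y * X = X * aeval Y (Polynomial.X + Polynomial.X ^ 2 * u) +
      aeval Y (Polynomial.X ^ 2 * u))
    (htop : ∀ a, a ∈ weightSubmodule X Y 0)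
    (ε : A →ₐ[ZMod 2] ZMod 2) (hεX : ε X = 0) (hεY : ε Y = 0) (k : ℕ) {z : A}
    (hz : z ∈ RingHom.ker ε ^ k) : z ∈ weightSubmodule X Y k := by
  induction k generalizing z with
  | zero => exact htop z
  | succ k ih =>
    rw [Ideal.IsTwoSided.pow_succ] at hz
    refine Submodule.mul_induction_on hz (fun a ha b hb => ?_) fun _ _ => add_mem
    obtain ⟨p, q, rfl⟩ := htop a
    -- The augmentation of `a = p(Y) + X * q(Y)` is the constant term of `p`, so it vanishes.
    have hp : Polynomial.X ∣ p := by
      rw [X_dvd_iff, coeff_zero_eq_eval_zero]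
      rw [RingHom.mem_ker, map_add, map_mul ε X, hεX, zero_mul, add_zero, pow_zero, one_mul,
        ← aeval_algHom_apply, hεY] at ha
      simpa [aeval_def, eval₂_eq_eval_map] using ha
    obtain ⟨p, rfl⟩ := hp
    have hb := ih hb
    rw [add_mul, mul_assoc X]
    refine add_mem ?_ (X_mul_mem_weightSubmodule hX (aeval_mul_mem_weightSubmodule hYX _ hb))
    rw [pow_zero, one_mul, map_mul, aeval_X, mul_assoc]
    exact Y_mul_mem_weightSubmodule hYX (aeval_mul_mem_weightSubmodule hYX _ hb)

theorem weightSubmodule_eq_bot {n : ℕ} (hY : Y ^ n = 0) : weightSubmodule X Y (n + 1) = ⊥ := by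
  rw [eq_bot_iff]
  rintro _ ⟨p, q, rfl⟩
  simp [pow_succ, hY]

end Filtration

/-- In characteristic 2, `(1 + X) ^ 2 - 1 = X ^ 2`. This is where the parities of `t` and `e` enter.
-/
theorem X_sq_dvd_one_add_X_pow_even (m : ℕ) :
    (Polynomial.X : (ZMod 2)[X]) ^ 2 ∣ (1 + Polynomial.X) ^ (2 * m) - 1 := by
  have h : (1 + Polynomial.X : (ZMod 2)[X]) ^ 2 - 1 = Polynomial.X ^ 2 := by
    rw [CharTwo.add_sq]; ring
  have := sub_dvd_pow_sub_pow ((1 + Polynomial.X : (ZMod 2)[X]) ^ 2) 1 m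
  rwa [h, one_pow, ← pow_mul] at this

theorem X_sq_dvd_one_add_X_pow_odd (m : ℕ) :
    (Polynomial.X : (ZMod 2)[X]) ^ 2 ∣
      (1 + Polynomial.X) ^ (2 * m + 1) - (1 + Polynomial.X) := by
  have := (X_sq_dvd_one_add_X_pow_even m).mul_right (1 + Polynomial.X)
  rwa [sub_mul, one_mul, ← pow_succ] at this

/-! ### Augmentation ideal, Jacobson radical and product-one subsequences -/

section GroupAlgebra

variable {G : Type*} [Group G]

/-- The augmentation of the group algebra over the field with two elements. -/
noncomputable def augmentation (G : Type*) [Group G] : MonoidAlgebra (ZMod 2) G →ₐ[ZMod 2] ZMod 2 :=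
  MonoidAlgebra.lift (ZMod 2) (ZMod 2) G 1

theorem augmentation_of (g : G) : augmentation G (of (ZMod 2) G g) = 1 := by
  simp [augmentation]

theorem jacobson_le_ker_augmentation :
    Ring.jacobson (MonoidAlgebra (ZMod 2) G) ≤ RingHom.ker (augmentation G) := by
  have : (RingHom.ker (augmentation G)).IsMaximal :=
    RingHom.ker_isMaximal_of_surjective _ fun c =>
      ⟨algebraMap _ _ c, by rw [AlgHom.commutes, Algebra.algebraMap_self_apply]⟩
  exact Ring.jacobson_le_of_isMaximal _

/-- For `a` in the nilpotent ideal, every `b * a` is nilpotent, so `b * a + 1` is a unit. -/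
theorem ker_augmentation_le_jacobson {k : ℕ} (hk : RingHom.ker (augmentation G) ^ k = ⊥) :
    RingHom.ker (augmentation G) ≤ Ring.jacobson (MonoidAlgebra (ZMod 2) G) := by
  intro a ha
  rw [← Ideal.jacobson_bot, Ideal.mem_jacobson_iff]
  intro b
  have hba : b * a ∈ RingHom.ker (augmentation G) := Ideal.mul_mem_left _ _ ha
  have hnil : IsNilpotent (b * a) := ⟨k, by
    rw [← Ideal.mem_bot, ← hk]; exact Ideal.pow_mem_pow hba k⟩
  obtain ⟨v, hv⟩ := hnil.isUnit_add_one
  refine ⟨↑v⁻¹, ?_⟩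
  rw [Ideal.mem_bot, mul_assoc, sub_eq_zero]
  calc (↑v⁻¹ : MonoidAlgebra (ZMod 2) G) * (b * a) + ↑v⁻¹ = ↑v⁻¹ * (b * a + 1) := by
        rw [mul_add, mul_one]
    _ = 1 := by rw [← hv, Units.inv_mul]

/-- If no non-empty subsequence of `S` has product one, then the product of the elements `g - 1`,
for `g` in `S`, is non-zero in the group algebra. -/
theorem prod_of_sub_one_ne_zero (S : List G)
    (hS : ∀ T : List G, T ≠ [] → T.Sublist S → T.prod ≠ 1) :
    (S.map fun g => of (ZMod 2) G g - 1).prod ≠ 0 := by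
  -- Expanding the product over all sublists, the empty one gives `1`, and signs do not matter in
  -- characteristic 2. If no non-empty sublist has product one, the coefficient at the identity is
  -- therefore `1`.
  have key : ∀ S : List G, (S.map fun g => of (ZMod 2) G g - 1).prod - 1 ∈
      Submodule.span (ZMod 2) {a | ∃ T : List G, T ≠ [] ∧ T.Sublist S ∧
        a = of (ZMod 2) G T.prod} := by
    intro S
    induction S with
    | nil => simp
    | cons g S ih =>
      set P := (S.map fun g => of (ZMod 2) G g - 1).prod with hP
      have hsplit : ((g :: S).map fun g => of (ZMod 2) G g - 1).prod - 1 =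
          of (ZMod 2) G g * (P - 1) + of (ZMod 2) G g + (P - 1) := by
        rw [List.map_cons, List.prod_cons, ← hP]
        have : (of (ZMod 2) G g - 1) * P - 1 = of (ZMod 2) G g * (P - 1) + of (ZMod 2) G g +
          (P - 1) - 2 * P := by noncomm_ring
        rw [this, two_eq_zero_of_algebra, zero_mul, sub_zero]
      rw [hsplit]
      refine add_mem (add_mem ?_ ?_) ?_
      · have := Submodule.mem_map_of_mem
          (f := LinearMap.mulLeft (ZMod 2) (of (ZMod 2) G g)) ih
        rw [Submodule.map_span] at this
        refine Submodule.span_mono ?_ this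
        rintro _ ⟨_, ⟨T, hT, hTS, rfl⟩, rfl⟩
        exact ⟨g :: T, by simp, hTS.cons_cons g, by
          rw [List.prod_cons, map_mul, LinearMap.mulLeft_apply]⟩
      · exact Submodule.subset_span ⟨[g], by simp, by simp, by simp⟩
      · refine Submodule.span_mono ?_ ih
        rintro _ ⟨T, hT, hTS, rfl⟩
        exact ⟨T, hT, hTS.cons g, rfl⟩
  intro h0
  have hmem := key S
  have hz : ∀ a ∈ Submodule.span (ZMod 2) {a | ∃ T : List G, T ≠ [] ∧ T.Sublist S ∧
        a = of (ZMod 2) G T.prod}, a.coeff 1 = 0 := by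
    intro a ha
    induction ha using Submodule.span_induction with
    | mem a h =>
      obtain ⟨T, hT, hTS, rfl⟩ := h
      classical
      rw [of_apply, coeff_single, Finsupp.single_apply, if_neg (hS T hT hTS)]
    | zero => simp
    | add a b _ _ ha hb => simp [ha, hb]
    | smul c a _ ha => simp [ha]
  rw [h0, zero_sub] at hmem
  have := hz _ (neg_mem_iff.mp hmem)
  simp [one_def] at this

theorem prod_of_sub_one_mem_pow {I : Ideal (MonoidAlgebra (ZMod 2) G)} [I.IsTwoSided]
    (hI : ∀ g : G, of (ZMod 2) G g - 1 ∈ I) (S : List G) :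
    (S.map fun g => of (ZMod 2) G g - 1).prod ∈ I ^ S.length := by
  induction S with
  | nil => rw [List.length_nil, Submodule.pow_zero, Ideal.one_eq_top]; exact Submodule.mem_top
  | cons g S ih =>
    rw [List.map_cons, List.prod_cons, List.length_cons, Ideal.IsTwoSided.pow_succ]
    exact Ideal.mul_mem_mul (hI g) ih

/-- If the `(n + 1)`-st power of the augmentation ideal vanishes and some sequence of length `n`
has no non-empty product-one subsequence, then both invariants are `n + 1`. -/
theorem orderedDavenport_and_loewyLength_eq {n : ℕ}
    (hker : RingHom.ker (augmentation G) ^ (n + 1) = ⊥) (S : List G) (hlen : S.length = n)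
    (hS : ∀ T : List G, T ≠ [] → T.Sublist S → T.prod ≠ 1) :
    orderedDavenport G = n + 1 ∧ loewyLength 2 G = n + 1 := by
  have hJ : Ring.jacobson (MonoidAlgebra (ZMod 2) G) = RingHom.ker (augmentation G) :=
    le_antisymm jacobson_le_ker_augmentation (ker_augmentation_le_jacobson hker)
  have hmem : ∀ g : G, of (ZMod 2) G g - 1 ∈ RingHom.ker (augmentation G) := fun g => by
    rw [RingHom.mem_ker, map_sub, map_one, augmentation_of, sub_self]
  constructor
  · refine IsLeast.csInf_eq ⟨⟨n.succ_pos, fun S' hS' => ?_⟩, fun k hk => ?_⟩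
    · by_contra! hcon
      refine prod_of_sub_one_ne_zero S' hcon ?_
      rw [← Ideal.mem_bot, ← hker, ← hS']
      exact prod_of_sub_one_mem_pow hmem S'
    · by_contra! hlt
      obtain ⟨T, hT, hTS, hprod⟩ := hk.2 (S.take k) (by rw [List.length_take]; omega)
      exact hS T hT (hTS.trans (List.take_sublist k S)) hprod
  · refine IsLeast.csInf_eq ⟨by rw [Set.mem_ofPred_eq, hJ, hker], fun k hk => ?_⟩
    by_contra! hlt
    rw [Set.mem_ofPred_eq, hJ] at hk
    refine prod_of_sub_one_ne_zero S hS ?_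
    rw [← Ideal.mem_bot, ← hk]
    exact Ideal.pow_le_pow_right (by omega) (prod_of_sub_one_mem_pow hmem S)

end GroupAlgebra

/-! ### Groups with normal forms `b ^ j` and `a * b ^ j` -/

section CyclicIndexTwo

theorem inv_eq_pow_sub_one {H : Type*} [Group H] {b : H} {n : ℕ} (hn : 0 < n) (hb : b ^ n = 1) :
    b⁻¹ = b ^ (n - 1) := by
  rw [inv_eq_iff_mul_eq_one, ← pow_succ', Nat.sub_add_cancel hn, hb]

variable {G : Type*} [Group G] {a b : G} {n t e : ℕ}

theorem eq_pow_or_eq_mul_pow (hn : 0 < n) (hgen : Subgroup.closure {a, b} = ⊤)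
    (hb : b ^ n = 1) (ha : a ^ 2 = b ^ t) (hba : b * a = a * b ^ e) (g : G) :
    ∃ j : ℕ, g = b ^ j ∨ g = a * b ^ j := by
  have hmula : ∀ g : G, (∃ j : ℕ, g = b ^ j ∨ g = a * b ^ j) →
      ∃ j : ℕ, a * g = b ^ j ∨ a * g = a * b ^ j := by
    rintro g ⟨j, rfl | rfl⟩
    · exact ⟨j, .inr rfl⟩
    · exact ⟨t + j, .inl (by rw [← mul_assoc, ← sq, ha, pow_add])⟩
  have hmulb : ∀ g : G, (∃ j : ℕ, g = b ^ j ∨ g = a * b ^ j) →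
      ∃ j : ℕ, b * g = b ^ j ∨ b * g = a * b ^ j := by
    rintro g ⟨j, rfl | rfl⟩
    · exact ⟨j + 1, .inl (pow_succ' b j).symm⟩
    · exact ⟨e + j, .inr (by rw [← mul_assoc, hba, mul_assoc, pow_add])⟩
  have hpow : ∀ c : G, (∀ g : G, (∃ j : ℕ, g = b ^ j ∨ g = a * b ^ j) →
      ∃ j : ℕ, c * g = b ^ j ∨ c * g = a * b ^ j) → ∀ (k : ℕ) (g : G),
      (∃ j : ℕ, g = b ^ j ∨ g = a * b ^ j) → ∃ j : ℕ, c ^ k * g = b ^ j ∨ c ^ k * g = a * b ^ j := by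
    intro c hc k
    induction k with
    | zero => intro g hg; simpa using hg
    | succ k ih => intro g hg; rw [pow_succ, mul_assoc]; exact ih _ (hc g hg)
  -- Both generators have finite order, so their inverses are natural powers and only left
  -- multiplication by `a` and `b` matters.
  have ha' : a ^ (2 * n) = 1 := by rw [pow_mul, ha, ← pow_mul, mul_comm, pow_mul, hb, one_pow]
  have hg : g ∈ Subgroup.closure {a, b} := hgen ▸ Subgroup.mem_top g
  induction hg using Subgroup.closure_induction_left with
  | one => exact ⟨0, .inl (pow_zero b).symm⟩
  | mul_left c hc g _ ih =>
    rcases hc with rfl | rfl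
    · exact hmula g ih
    · exact hmulb g ih
  | inv_mul_cancel c hc g _ ih =>
    rcases hc with rfl | rfl
    · rw [inv_eq_pow_sub_one (by omega) ha']; exact hpow c hmula _ g ih
    · rw [inv_eq_pow_sub_one hn hb]; exact hpow c hmulb _ g ih

theorem card_eq_two_mul (hn : 0 < n) (hgen : Subgroup.closure {a, b} = ⊤)
    (hb : b ^ n = 1) (ha : a ^ 2 = b ^ t) (hba : b * a = a * b ^ e)
    (hord : ∀ j : ℕ, b ^ j = 1 → n ∣ j) (hne : ∀ i j : ℕ, b ^ i ≠ a * b ^ j) :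
    Nat.card G = 2 * n := by
  have hordb : orderOf b = n := Nat.dvd_antisymm (orderOf_dvd_of_pow_eq_one hb)
    (hord _ (pow_orderOf_eq_one b))
  have hinj : ∀ i j : Fin n, b ^ (i : ℕ) = b ^ (j : ℕ) → i = j := fun i j h =>
    Fin.ext (pow_injOn_Iio_orderOf (by simp [hordb]) (by simp [hordb]) h)
  have hbij : Function.Bijective
      (Sum.elim (fun j => b ^ (j : ℕ)) (fun j => a * b ^ (j : ℕ)) : Fin n ⊕ Fin n → G) := by
    constructor
    · rintro (i | i) (j | j) h
      · exact congrArg _ (hinj i j h)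
      · exact absurd h (hne i j)
      · exact absurd h.symm (hne j i)
      · exact congrArg _ (hinj i j (mul_left_cancel h))
    · intro g
      obtain ⟨j, rfl | rfl⟩ := eq_pow_or_eq_mul_pow hn hgen hb ha hba g
      · exact ⟨.inl ⟨j % n, Nat.mod_lt _ hn⟩, by simp [← hordb, pow_mod_orderOf]⟩
      · exact ⟨.inr ⟨j % n, Nat.mod_lt _ hn⟩, by simp [← hordb, pow_mod_orderOf]⟩
  rw [← Nat.card_eq_of_bijective _ hbij]
  simp [two_mul]

/-- The sequence consisting of `a` followed by `n - 1` copies of `b` has no non-empty product-one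
subsequence. -/
theorem prod_ne_one_of_sublist (hord : ∀ j : ℕ, b ^ j = 1 → n ∣ j)
    (hne : ∀ i j : ℕ, b ^ i ≠ a * b ^ j) (T : List G) (hT : T ≠ [])
    (hTS : T.Sublist (a :: List.replicate (n - 1) b)) : T.prod ≠ 1 := by
  intro hprod
  rcases List.sublist_cons_iff.mp hTS with h | ⟨T', rfl, h⟩ <;>
    obtain ⟨j, hj, rfl⟩ := List.sublist_replicate_iff.mp h
  · rw [List.prod_replicate] at hprod
    have hj0 : 0 < j := Nat.pos_of_ne_zero (by rintro rfl; exact hT rfl)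
    have := Nat.le_of_dvd hj0 (hord j hprod)
    omega
  · rw [List.prod_cons, List.prod_replicate] at hprod
    exact hne 0 j (by rw [pow_zero, hprod])

theorem ker_augmentation_pow_eq_bot {s m l : ℕ} (hgen : Subgroup.closure {a, b} = ⊤)
    (hb : b ^ 2 ^ s = 1) (ha : a ^ 2 = b ^ (2 * m)) (hba : b * a = a * b ^ (2 * l + 1)) :
    RingHom.ker (augmentation G) ^ (2 ^ s + 1) = ⊥ := by
  set α := of (ZMod 2) G a with hα
  set β := of (ZMod 2) G b with hβ
  have hpoly : ∀ j : ℕ, β ^ j = aeval (β - 1) ((1 + Polynomial.X) ^ j : (ZMod 2)[X]) := by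
    intro j; simp
  obtain ⟨w, hw⟩ := X_sq_dvd_one_add_X_pow_even m
  obtain ⟨u, hu⟩ := X_sq_dvd_one_add_X_pow_odd l
  have hα2 : α ^ 2 = β ^ (2 * m) := by rw [← map_pow, ha, map_pow]
  have hβα : β * α = α * β ^ (2 * l + 1) := by rw [← map_mul, hba, map_mul, map_pow]
  have hβs : β ^ 2 ^ s = 1 := by rw [← map_pow, hb, map_one]
  have hX : (α - 1) * (α - 1) = aeval (β - 1) (Polynomial.X ^ 2 * w) := by
    rw [← hw, map_sub, ← hpoly, ← hα2, map_one]
    have : (α - 1) * (α - 1) = α ^ 2 - 1 - 2 * (α - 1) := by noncomm_ring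
    rw [this, two_eq_zero_of_algebra, zero_mul, sub_zero]
  have hYX : (β - 1) * (α - 1) =
      (α - 1) * aeval (β - 1) (Polynomial.X + Polynomial.X ^ 2 * u) +
        aeval (β - 1) (Polynomial.X ^ 2 * u) := by
    rw [← hu, map_add, map_sub, ← hpoly]
    simp only [map_add, map_one, aeval_X]
    have : (β - 1) * (α - 1) = β * α - α - β + 1 := by noncomm_ring
    rw [this, hβα]
    noncomm_ring
  -- Frobenius: `(1 + X) ^ 2 ^ s = 1 + X ^ 2 ^ s`.
  have hY : (β - 1) ^ 2 ^ s = 0 := by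
    have h : (Polynomial.X : (ZMod 2)[X]) ^ 2 ^ s = (1 + Polynomial.X) ^ 2 ^ s - 1 := by
      rw [add_pow_char_pow, one_pow, add_sub_cancel_left]
    have := congrArg (aeval (β - 1)) h
    rwa [map_sub, ← hpoly, hβs, map_one, sub_self, map_pow, aeval_X] at this
  have htop : ∀ z, z ∈ weightSubmodule (α - 1) (β - 1) 0 := by
    intro z
    induction z using MonoidAlgebra.induction_on with
    | of g =>
      obtain ⟨j, rfl | rfl⟩ := eq_pow_or_eq_mul_pow (by positivity) hgen hb ha hba g
      · exact ⟨(1 + Polynomial.X) ^ j, 0, by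
          rw [map_pow, ← hβ, hpoly]; simp⟩
      · exact ⟨(1 + Polynomial.X) ^ j, (1 + Polynomial.X) ^ j, by
          rw [map_mul, map_pow, ← hβ, ← hα, pow_zero, one_mul, ← hpoly, sub_mul, one_mul,
            add_sub_cancel]⟩
    | add x y hx hy => exact add_mem hx hy
    | smul c x hx => exact Submodule.smul_mem _ _ hx
  rw [eq_bot_iff]
  intro z hz
  have := ker_pow_le_weightSubmodule hX hYX htop (augmentation G)
    (by rw [map_sub, map_one, augmentation_of, sub_self])
    (by rw [map_sub, map_one, augmentation_of, sub_self]) _ hz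
  rwa [weightSubmodule_eq_bot hY, Submodule.mem_bot] at this

end CyclicIndexTwo

/-! ### A permutation model of the normal forms -/

section Model

/-- Left multiplication by `x` on the normal forms `x ^ i * y ^ j`, where `x ^ 2 = y ^ t`. -/
def modelX (n : ℕ) (t : ZMod n) : Equiv.Perm (Bool × ZMod n) where
  toFun p := (!p.1, if p.1 then p.2 + t else p.2)
  invFun p := (!p.1, if p.1 then p.2 else p.2 - t)
  left_inv := by rintro ⟨_ | _, j⟩ <;> simp
  right_inv := by rintro ⟨_ | _, j⟩ <;> simp

/-- Left multiplication by `y` on the normal forms `x ^ i * y ^ j`, where `y * x = x * y ^ e`. -/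
def modelY (n : ℕ) (e : ZMod n) : Equiv.Perm (Bool × ZMod n) where
  toFun p := (p.1, p.2 + if p.1 then e else 1)
  invFun p := (p.1, p.2 - if p.1 then e else 1)
  left_inv := by rintro ⟨_ | _, j⟩ <;> simp
  right_inv := by rintro ⟨_ | _, j⟩ <;> simp

variable {n : ℕ}

theorem modelX_apply (t : ZMod n) (i : Bool) (j : ZMod n) :
    modelX n t (i, j) = (!i, if i then j + t else j) := rfl

theorem modelY_pow_apply (e : ZMod n) (k : ℕ) (i : Bool) (j : ZMod n) :
    (modelY n e ^ k) (i, j) = (i, j + k * if i then e else 1) := by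
  induction k generalizing j with
  | zero => simp
  | succ k ih =>
    rw [pow_succ, Equiv.Perm.mul_apply]
    change (modelY n e ^ k) (i, j + if i then e else 1) = _
    rw [ih]
    push_cast
    congr 1
    ring

theorem modelY_pow_card (e : ZMod n) : modelY n e ^ n = 1 := by
  ext1 ⟨i, j⟩
  rw [modelY_pow_apply]
  simp

/-- On the half `x * y ^ j`, `y ^ t` shifts by `t * e` and `x ^ 2` by `t`; `hte` says that `x`
commutes with `x ^ 2 = y ^ t`. -/
theorem modelX_sq {t e : ℕ} (hte : (t : ZMod n) * e = t) :
    modelX n t ^ 2 = modelY n e ^ t := by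
  ext1 ⟨i, j⟩
  rw [modelY_pow_apply, sq, Equiv.Perm.mul_apply, modelX_apply, modelX_apply]
  cases i <;> simp [hte]

/-- On the half `x * y ^ j`, the sides shift by `t + 1` and `e * e + t`; `hee` says that conjugating
`y` twice by `x` is trivial. -/
theorem modelY_mul_modelX (t : ZMod n) {e : ℕ} (hee : (e : ZMod n) * e = 1) :
    modelY n e * modelX n t = modelX n t * modelY n e ^ e := by
  ext1 ⟨i, j⟩
  rw [← pow_one (modelY n e), ← pow_mul, Equiv.Perm.mul_apply, Equiv.Perm.mul_apply,
    modelY_pow_apply, modelX_apply, modelY_pow_apply, modelX_apply]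
  cases i <;> simp [hee, add_right_comm]

end Model

/-- A group presented by the relations `x ^ 2 = y ^ t`, `y ^ (2 ^ s) = 1` and `y * x = x * y ^ e`,
with `t` even, `e` odd, `e ^ 2 = 1` and `t * e = t` modulo `2 ^ s`. -/
theorem presentedGroup_invariants (rels : Set (FreeGroup (Fin 2))) {s t e : ℕ} (ht : Even t)
    (he : Odd e) (hee : (e : ZMod (2 ^ s)) * e = 1) (hte : (t : ZMod (2 ^ s)) * e = t)
    (hrels : ∀ (H : Type) [Group H] (a b : H), (∀ w ∈ rels, FreeGroup.lift ![a, b] w = 1) ↔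
      a ^ 2 = b ^ t ∧ b ^ 2 ^ s = 1 ∧ b * a = a * b ^ e) :
    Nat.card (PresentedGroup rels) = 2 ^ (s + 1) ∧
      orderedDavenport (PresentedGroup rels) = loewyLength 2 (PresentedGroup rels) ∧
      loewyLength 2 (PresentedGroup rels) = 2 ^ s + 1 := by
  set a : PresentedGroup rels := PresentedGroup.of 0 with ha_def
  set b : PresentedGroup rels := PresentedGroup.of 1 with hb_def
  have hlift : FreeGroup.lift ![a, b] = PresentedGroup.mk rels := by
    ext i
    fin_cases i <;> simp [ha_def, hb_def, PresentedGroup.of]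
  -- `hrels` ranges over all groups because it is used twice: here to extract relations in the
  -- presented group, and below to map that group to the model.
  obtain ⟨ha, hb, hba⟩ := (hrels _ a b).mp fun w hw => by
    rw [hlift]
    exact (QuotientGroup.eq_one_iff w).mpr (Subgroup.subset_normalClosure hw)
  have hgen : Subgroup.closure {a, b} = ⊤ := by
    rw [← PresentedGroup.closure_range_of rels]
    congr 1
    ext g
    simp [ha_def, hb_def, eq_comm]
  let ψ := PresentedGroup.toGroup ((hrels _ (modelX (2 ^ s) t) (modelY (2 ^ s) e)).mpr
    ⟨modelX_sq hte, modelY_pow_card _, modelY_mul_modelX _ hee⟩)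
  have hψa : ψ a = modelX (2 ^ s) t := PresentedGroup.toGroup.of _
  have hψb : ψ b = modelY (2 ^ s) e := PresentedGroup.toGroup.of _
  have hord : ∀ j : ℕ, b ^ j = 1 → 2 ^ s ∣ j := by
    intro j hj
    -- The point `(false, 0)` is the normal form of the identity, so its image under `ψ g` reads off
    -- the normal form of `g`.
    have h := congrArg (fun g => (ψ g (false, 0)).2) hj
    simp only [map_pow, hψb, modelY_pow_apply, map_one] at h
    simpa [ZMod.natCast_eq_zero_iff] using h
  have hne : ∀ i j : ℕ, b ^ i ≠ a * b ^ j := by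
    intro i j hij
    have h := congrArg (fun g => (ψ g (false, 0)).1) hij
    simp [hψa, hψb, modelY_pow_apply, modelX_apply] at h
  obtain ⟨m, rfl⟩ := ht.two_dvd
  obtain ⟨l, rfl⟩ := he
  have hs : 0 < 2 ^ s := by positivity
  obtain ⟨hD, hL⟩ := orderedDavenport_and_loewyLength_eq
    (ker_augmentation_pow_eq_bot hgen hb ha hba) (a :: List.replicate (2 ^ s - 1) b)
    (by simp; omega) (prod_ne_one_of_sublist hord hne)
  refine ⟨?_, hD.trans hL.symm, hL⟩
  rw [card_eq_two_mul hs hgen hb ha hba hord hne, pow_succ']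

/-! ### Parameters and congruences for the four families -/

theorem inv_mul_mul_mul_inv_eq_one_iff {H : Type*} [Group H] {a b c : H} :
    a⁻¹ * b * a * c⁻¹ = 1 ↔ b * a = a * c := by
  rw [mul_inv_eq_one, mul_assoc, inv_mul_eq_iff_eq_mul]

theorem odd_two_pow_sub_one {k : ℕ} (hk : 0 < k) : Odd (2 ^ k - 1) :=
  Nat.Even.sub_odd Nat.one_le_two_pow ((Nat.even_pow).mpr ⟨even_two, hk.ne'⟩) odd_one

theorem natCast_pow_sub_one (s : ℕ) : ((2 ^ s - 1 : ℕ) : ZMod (2 ^ s)) = -1 := by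
  rw [Nat.cast_sub Nat.one_le_two_pow, ZMod.natCast_self]
  simp

theorem dihedral_invariants {s : ℕ} (hs : 0 < s) : Nat.card (Dihedral (s + 1)) = 2 ^ (s + 1) ∧
    orderedDavenport (Dihedral (s + 1)) = loewyLength 2 (Dihedral (s + 1)) ∧
    loewyLength 2 (Dihedral (s + 1)) = 2 ^ s + 1 := by
  refine presentedGroup_invariants _ (t := 0) (e := 2 ^ s - 1) Even.zero (odd_two_pow_sub_one hs)
    (by rw [natCast_pow_sub_one]; ring) (by simp) fun H _ a b => ?_
  simp only [Set.mem_insert_iff, Set.mem_singleton_iff, forall_eq_or_imp, forall_eq, map_mul,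
    map_pow, map_inv, FreeGroup.lift_apply_of, Matrix.cons_val_zero, Matrix.cons_val_one,
    inv_mul_mul_mul_inv_eq_one_iff, add_tsub_cancel_right, pow_zero]
  -- Given `b ^ 2 ^ s = 1`, the relator's `b⁻¹` is the natural power `b ^ (2 ^ s - 1)`.
  refine and_congr_right fun _ => and_congr_right fun hb => ?_
  rw [inv_eq_pow_sub_one (by positivity) hb]

theorem quaternion_invariants {k : ℕ} (hk : 0 < k) : Nat.card (Quaternion (k + 2)) = 2 ^ (k + 2) ∧
    orderedDavenport (Quaternion (k + 2)) = loewyLength 2 (Quaternion (k + 2)) ∧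
    loewyLength 2 (Quaternion (k + 2)) = 2 ^ (k + 1) + 1 := by
  have h0 : (2 : ZMod (2 ^ (k + 1))) ^ (k + 1) = 0 := by
    exact_mod_cast ZMod.natCast_self (2 ^ (k + 1))
  refine presentedGroup_invariants _ (t := 2 ^ k) (e := 2 ^ (k + 1) - 1)
    ((Nat.even_pow).mpr ⟨even_two, hk.ne'⟩) (odd_two_pow_sub_one k.succ_pos)
    (by rw [natCast_pow_sub_one]; ring)
    -- `-2 ^ k = 2 ^ k` modulo `2 ^ (k + 1)`.
    (by rw [natCast_pow_sub_one]; push_cast; linear_combination -h0) fun H _ a b => ?_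
  simp only [Set.mem_insert_iff, Set.mem_singleton_iff, forall_eq_or_imp, forall_eq, map_mul,
    map_pow, map_inv, FreeGroup.lift_apply_of, Matrix.cons_val_zero, Matrix.cons_val_one,
    inv_mul_mul_mul_inv_eq_one_iff, mul_inv_eq_one (a := a ^ 2), add_tsub_cancel_right,
    show k + 2 - 1 = k + 1 from rfl]
  refine and_congr_right fun _ => and_congr_right fun hb => ?_
  rw [inv_eq_pow_sub_one (by positivity) hb]

theorem semidihedral_invariants {k : ℕ} (hk : 2 ≤ k) :
    Nat.card (Semidihedral (k + 2)) = 2 ^ (k + 2) ∧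
    orderedDavenport (Semidihedral (k + 2)) = loewyLength 2 (Semidihedral (k + 2)) ∧
    loewyLength 2 (Semidihedral (k + 2)) = 2 ^ (k + 1) + 1 := by
  have h0 : (2 : ZMod (2 ^ (k + 1))) ^ (k + 1) = 0 := by
    exact_mod_cast ZMod.natCast_self (2 ^ (k + 1))
  refine presentedGroup_invariants _ (t := 0) (e := 2 ^ k - 1)
    Even.zero (odd_two_pow_sub_one (by omega)) ?_ (by simp) fun H _ a b => ?_
  -- With `k = c + 2`, `(2 ^ k - 1) ^ 2 - 1 = 2 ^ (2 * k) - 2 ^ (k + 1) = (2 ^ (c + 1) - 1) * 2 ^ (k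
  -- + 1)`.
  · obtain ⟨c, rfl⟩ := Nat.exists_eq_add_of_le' hk
    rw [Nat.cast_sub Nat.one_le_two_pow]
    push_cast
    linear_combination (2 ^ (c + 1) - 1) * h0
  simp only [Set.mem_insert_iff, Set.mem_singleton_iff, forall_eq_or_imp, forall_eq, map_mul,
    map_pow, map_inv, FreeGroup.lift_apply_of, Matrix.cons_val_zero, Matrix.cons_val_one,
    inv_mul_mul_mul_inv_eq_one_iff, add_tsub_cancel_right, pow_zero,
    show k + 2 - 1 = k + 1 from rfl]

theorem modular_invariants {k : ℕ} (hk : 2 ≤ k) :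
    Nat.card (Modular (k + 2)) = 2 ^ (k + 2) ∧
    orderedDavenport (Modular (k + 2)) = loewyLength 2 (Modular (k + 2)) ∧
    loewyLength 2 (Modular (k + 2)) = 2 ^ (k + 1) + 1 := by
  have h0 : (2 : ZMod (2 ^ (k + 1))) ^ (k + 1) = 0 := by
    exact_mod_cast ZMod.natCast_self (2 ^ (k + 1))
  refine presentedGroup_invariants _ (t := 0) (e := 2 ^ k + 1)
    Even.zero (((Nat.even_pow).mpr ⟨even_two, by omega⟩).add_odd odd_one) ?_ (by simp)
    fun H _ a b => ?_
  -- Likewise `(2 ^ k + 1) ^ 2 - 1 = (2 ^ (c + 1) + 1) * 2 ^ (k + 1)`.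
  · obtain ⟨c, rfl⟩ := Nat.exists_eq_add_of_le' hk
    push_cast
    linear_combination (2 ^ (c + 1) + 1) * h0
  simp only [Set.mem_insert_iff, Set.mem_singleton_iff, forall_eq_or_imp, forall_eq, map_mul,
    map_pow, map_inv, FreeGroup.lift_apply_of, Matrix.cons_val_zero, Matrix.cons_val_one,
    inv_mul_mul_mul_inv_eq_one_iff, add_tsub_cancel_right, pow_zero,
    show k + 2 - 1 = k + 1 from rfl]

end TwoGroups

theorem theorem1p6 (r : ℕ) :
    (3 ≤ r → Nat.card (TwoGroups.Dihedral r) = 2 ^ r ∧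
      TwoGroups.orderedDavenport (TwoGroups.Dihedral r) =
        TwoGroups.loewyLength 2 (TwoGroups.Dihedral r) ∧
      TwoGroups.loewyLength 2 (TwoGroups.Dihedral r) = 2 ^ (r - 1) + 1) ∧
    (3 ≤ r → Nat.card (TwoGroups.Quaternion r) = 2 ^ r ∧
      TwoGroups.orderedDavenport (TwoGroups.Quaternion r) =
        TwoGroups.loewyLength 2 (TwoGroups.Quaternion r) ∧
      TwoGroups.loewyLength 2 (TwoGroups.Quaternion r) = 2 ^ (r - 1) + 1) ∧
    (4 ≤ r → Nat.card (TwoGroups.Semidihedral r) = 2 ^ r ∧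
      TwoGroups.orderedDavenport (TwoGroups.Semidihedral r) =
        TwoGroups.loewyLength 2 (TwoGroups.Semidihedral r) ∧
      TwoGroups.loewyLength 2 (TwoGroups.Semidihedral r) = 2 ^ (r - 1) + 1) ∧
    (4 ≤ r → Nat.card (TwoGroups.Modular r) = 2 ^ r ∧
      TwoGroups.orderedDavenport (TwoGroups.Modular r) =
        TwoGroups.loewyLength 2 (TwoGroups.Modular r) ∧
      TwoGroups.loewyLength 2 (TwoGroups.Modular r) = 2 ^ (r - 1) + 1) := by
  refine ⟨fun hr => ?_, fun hr => ?_, fun hr => ?_, fun hr => ?_⟩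
  · obtain ⟨s, rfl⟩ := Nat.exists_eq_add_of_le' (show 1 ≤ r by omega)
    exact TwoGroups.dihedral_invariants (by omega)
  all_goals obtain ⟨k, rfl⟩ := Nat.exists_eq_add_of_le' (show 2 ≤ r by omega)
  · exact TwoGroups.quaternion_invariants (by omega)
  · exact TwoGroups.semidihedral_invariants (by omega)
  · exact TwoGroups.modular_invariants (by omega)
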